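/- Let $\Sigma$ be a finite group. A difference ring is a commutative ring with identity on which $\Sigma$ acts by ring automorphisms; a difference ideal is an ideal stable under $\Sigma$; a pseudofield is a nonzero absolutely flat difference ring whose only difference ideals are the two trivial ones. Let $A$ be a pseudofield. The ring $A\{y_1,\ldots,y_n\}$ of difference polynomials is the polynomial ring $A[\sigma y_i : \sigma\in\Sigma,\ 1\le i\le n]$ with $\Sigma$ acting on the coefficients and by $\tau(\sigma y_i)=(\tau\sigma)y_i$; its elements are evaluated at points of $A^n$ by substituting $\sigma(a_i)$ for $\sigma y_i$. For a set $E$ of difference polynomials let $V(E)\subseteq A^n$ be its set of common zeros, and for $X\subseteq A^n$ let $I(X)$ be the ideal of all difference polynomials vanishing on $X$. Assume that $A$ is difference closed, that is, $\sqrt{\mathfrak a}=I(V(\mathfrak a))$ for all $n$ and all difference ideals $\mathfrak a\subseteq A\{y_1,\ldots,y_n\}$. A pseudovariety is a set of the form $V(E)\subseteq A^n$. The sets $V(E)$ are the closed sets of a topology on $A^n$, and pseudovarieties carry the induced topology. Write $A\{X\}=A\{y_1,\ldots,y_n\}/I(X)$, identified with the ring of polynomial functions $X\to A$, and for $u\in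 A\{X\}$ put $X_u=\{x\in X : u(x)\neq 0\}$. A function $X\to A$ is regular if every point of $X$ has a neighbourhood on which the function is a quotient $h/g$ of difference polynomials, the values of $g$ there being invertible; a map $f\colon Y\to X$ between pseudovarieties $Y\subseteq A^m$ and $X\subseteq A^n$ is regular if its coordinate functions are regular. Such a map induces a homomorphism $f^*\colon A\{X\}\to A\{Y\}$, $u\mapsto u\circ f$. **Proposition.** Let $f\colon Y\to X$ be a regular map of pseudovarieties with dense image. Then there is an element $u\in A\{X\}$, with $X_u\neq\emptyset$ (equivalently $u\neq 0$) if $X\neq\emptyset$, such that the restriction $f\colon Y_{f^*(u)}\to X_u$ is an open map. -/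

import Mathlib

namespace DiffGeom

section Basic

variable (G : Type*) [Group G]

/-- An ideal of a difference ring (a commutative ring on which the group `G` acts by ring
automorphisms) is a difference ideal if it is stable under the action. -/
def IsDifferenceIdeal {R : Type*} [CommRing R] [MulSemiringAction G R] (I : Ideal R) : Prop :=
  ∀ σ : G, ∀ a ∈ I, σ • a ∈ I

/-- A pseudofield: a nonzero difference ring which is simple (it has no nontrivial difference
ideals) and absolutely flat (equivalently, von Neumann regular). -/
class IsPseudofield (A : Type*) [CommRing A] [MulSemiringAction G A] : Prop where
  nontrivial : Nontrivial A
  simple : ∀ I : Ideal A, IsDifferenceIdeal G I → I = ⊥ ∨ I = ⊤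
  absolutelyFlat : ∀ a : A, ∃ x : A, a = x * a ^ 2

/-- The ring `A{y₁, …, yₙ} = A[σ yᵢ : σ ∈ G, 1 ≤ i ≤ n]` of difference polynomials; the
variable with index `(σ, i)` is `σ yᵢ`. -/
def DiffPoly (A : Type*) [CommRing A] (n : ℕ) : Type _ := MvPolynomial (G × Fin n) A

/-- The set `A ^ n`. -/
def DiffAffine (_G : Type*) (A : Type*) (n : ℕ) : Type _ := Fin n → A

end Basic

variable {G : Type*} [Group G] {A : Type*} [CommRing A] {n m : ℕ}

noncomputable instance : CommRing (DiffPoly G A n) :=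
  inferInstanceAs (CommRing (MvPolynomial (G × Fin n) A))

noncomputable instance : Algebra A (DiffPoly G A n) :=
  inferInstanceAs (Algebra A (MvPolynomial (G × Fin n) A))

variable [MulSemiringAction G A]

namespace DiffPoly

/-- The variable `σ yᵢ`, where `p = (σ, i)`. -/
noncomputable def var (p : G × Fin n) : DiffPoly G A n :=
  (MvPolynomial.X p : MvPolynomial (G × Fin n) A)

/-- The action of `σ` on difference polynomials: it acts on the coefficients by the given action
and sends `τ yᵢ` to `(σ τ) yᵢ`. -/
noncomputable def act (σ : G) : DiffPoly G A n →+* DiffPoly G A n :=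
  MvPolynomial.eval₂Hom
    ((MvPolynomial.C : A →+* MvPolynomial (G × Fin n) A).comp (MulSemiringAction.toRingHom G A σ))
    (fun p => (MvPolynomial.X (σ * p.1, p.2) : MvPolynomial (G × Fin n) A))

theorem act_C (σ : G) (a : A) :
    act (n := n) σ (algebraMap A (DiffPoly G A n) a) = algebraMap A (DiffPoly G A n) (σ • a) :=
  MvPolynomial.eval₂Hom_C _ _ _

theorem act_X (σ : G) (p : G × Fin n) :
    act σ (var p : DiffPoly G A n) = var (σ * p.1, p.2) :=
  MvPolynomial.eval₂Hom_X' _ _ _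

theorem ringHom_ext {S : Type*} [CommSemiring S] {f g : DiffPoly G A n →+* S}
    (hC : ∀ a, f (algebraMap A (DiffPoly G A n) a) = g (algebraMap A (DiffPoly G A n) a))
    (hX : ∀ p, f (var p) = g (var p)) : f = g :=
  MvPolynomial.ringHom_ext hC hX

theorem act_one : act (1 : G) = RingHom.id (DiffPoly G A n) := by
  refine ringHom_ext (fun a => ?_) (fun p => ?_)
  · rw [act_C, one_smul]; rfl
  · rw [act_X, one_mul]; rfl

theorem act_mul (σ τ : G) :
    act (σ * τ) = (act σ).comp (act τ : DiffPoly G A n →+* DiffPoly G A n) := by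
  refine ringHom_ext (fun a => ?_) (fun p => ?_)
  · rw [RingHom.comp_apply, act_C, act_C, act_C, mul_smul]
  · rw [RingHom.comp_apply, act_X, act_X, act_X, mul_assoc]

noncomputable instance : MulSemiringAction G (DiffPoly G A n) where
  smul σ p := act σ p
  one_smul p := DFunLike.congr_fun act_one p
  mul_smul σ τ p := DFunLike.congr_fun (act_mul σ τ) p
  smul_zero σ := map_zero (act σ)
  smul_add σ := map_add (act σ)
  smul_one σ := map_one (act σ)
  smul_mul σ := map_mul (act σ)

theorem smul_def (σ : G) (p : DiffPoly G A n) : σ • p = act σ p := rfl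

/-- The value `f(a)` of a difference polynomial `f` at a point `a` of `A ^ n`: substitute `σ aᵢ`
for `σ yᵢ`. -/
noncomputable def evalAt (a : DiffAffine G A n) : DiffPoly G A n →ₐ[A] A :=
  MvPolynomial.aeval (fun p : G × Fin n => p.1 • (a p.2 : A))

theorem evalAt_X (a : DiffAffine G A n) (p : G × Fin n) :
    evalAt a (var p : DiffPoly G A n) = p.1 • (a p.2 : A) :=
  MvPolynomial.aeval_X _ _

theorem evalAt_smul (a : DiffAffine G A n) (σ : G) (p : DiffPoly G A n) :
    evalAt a (σ • p) = σ • evalAt a p := by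
  have : (evalAt a).toRingHom.comp (act σ) =
      (MulSemiringAction.toRingHom G A σ).comp (evalAt a).toRingHom := by
    refine ringHom_ext (fun b => ?_) (fun q => ?_)
    · change evalAt a (act σ (algebraMap A _ b)) = σ • evalAt a (algebraMap A _ b)
      rw [act_C, AlgHom.commutes, AlgHom.commutes]; rfl
    · change evalAt a (act σ _) = σ • evalAt a _
      rw [act_X, evalAt_X, evalAt_X, mul_smul]
  exact DFunLike.congr_fun this p

end DiffPoly

open DiffPoly

/-- The set `V(E)` of common zeros in `A ^ n` of a set `E` of difference polynomials. -/
def zeroLocus (E : Set (DiffPoly G A n)) : Set (DiffAffine G A n) :=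
  {a | ∀ f ∈ E, evalAt a f = 0}

/-- Evaluation of difference polynomials on a subset `X` of `A ^ n`. -/
noncomputable def evalOn (X : Set (DiffAffine G A n)) : DiffPoly G A n →ₐ[A] (X → A) :=
  AlgHom.pi (fun x : X => evalAt x.1)

theorem evalOn_apply (X : Set (DiffAffine G A n)) (f : DiffPoly G A n) (x : X) :
    evalOn X f x = evalAt x.1 f := rfl

/-- The ideal of definition `I(X)`: all difference polynomials that vanish on `X`. -/
noncomputable def vanishingIdeal (X : Set (DiffAffine G A n)) : Ideal (DiffPoly G A n) :=
  RingHom.ker (evalOn X)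

theorem mem_vanishingIdeal {X : Set (DiffAffine G A n)} {f : DiffPoly G A n} :
    f ∈ vanishingIdeal X ↔ ∀ x ∈ X, evalAt x f = 0 := by
  rw [vanishingIdeal, RingHom.mem_ker, funext_iff]
  exact ⟨fun h x hx => h ⟨x, hx⟩, fun h x => h x.1 x.2⟩

/-- A difference closed pseudofield: the difference Nullstellensatz `𝔯(𝔞) = I(V(𝔞))` holds for
all difference ideals `𝔞` of all rings of difference polynomials `A{y₁, …, yₙ}`. -/
class IsDifferenceClosed (G : Type*) [Group G] (A : Type*) [CommRing A] [MulSemiringAction G A] :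
    Prop extends IsPseudofield G A where
  radical_eq : ∀ (n : ℕ) (I : Ideal (DiffPoly G A n)), IsDifferenceIdeal G I →
    I.radical = vanishingIdeal (zeroLocus (I : Set (DiffPoly G A n)))

/-- Pseudovarieties are the sets `V(E)`. -/
def IsPseudovariety (X : Set (DiffAffine G A n)) : Prop :=
  ∃ E : Set (DiffPoly G A n), X = zeroLocus E

theorem exists_mul_smul_ne_zero [IsPseudofield G A] {a b : A} (ha : a ≠ 0) (hb : b ≠ 0) :
    ∃ σ : G, a * σ • b ≠ 0 := by
  by_contra! h
  let I : Ideal A :=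
    { carrier := {c | ∀ σ : G, c * σ • b = 0}
      add_mem' := fun {x y} hx hy σ => by
        rw [add_mul, show x * σ • b = 0 from hx σ, show y * σ • b = 0 from hy σ, add_zero]
      zero_mem' := fun σ => zero_mul _
      smul_mem' := fun c x hx σ => by
        rw [smul_eq_mul, mul_assoc, show x * σ • b = 0 from hx σ, mul_zero] }
  have hI : IsDifferenceIdeal G I := by
    intro τ c hc σ
    have h1 : c * (τ⁻¹ * σ) • b = 0 := hc (τ⁻¹ * σ)
    have h2 : τ • (c * (τ⁻¹ * σ) • b) = 0 := by rw [h1, smul_zero]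
    rwa [smul_mul', ← mul_smul, mul_inv_cancel_left] at h2
  rcases IsPseudofield.simple I hI with h0 | h1
  · have : a ∈ I := h
    rw [h0] at this
    exact ha this
  · have : (1 : A) ∈ I := h1 ▸ Submodule.mem_top
    have h2 : 1 * (1 : G) • b = 0 := this 1
    rw [one_smul, one_mul] at h2
    exact hb h2

/-- The topology on `A ^ n` whose closed sets are exactly the sets `V(E)`. -/
instance [IsPseudofield G A] : TopologicalSpace (DiffAffine G A n) :=
  TopologicalSpace.ofClosed {X | IsPseudovariety X}
    ⟨{1}, by
      have := IsPseudofield.nontrivial (G := G) (A := A)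
      ext a
      simp [zeroLocus]⟩
    (by
      intro S hS
      refine ⟨{f | ∃ X ∈ S, f ∈ vanishingIdeal X}, ?_⟩
      ext a
      constructor
      · rintro ha f ⟨X, hX, hf⟩
        exact mem_vanishingIdeal.1 hf a (ha X hX)
      · intro ha X hX
        obtain ⟨E, rfl⟩ := hS hX
        exact fun f hf => ha f ⟨_, hX, mem_vanishingIdeal.2 fun x hx => hx f hf⟩)
    (by
      rintro _ ⟨E, rfl⟩ _ ⟨F, rfl⟩
      refine ⟨{p | ∃ f ∈ E, ∃ g ∈ F, ∃ σ : G, p = f * σ • g}, ?_⟩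
      ext a
      constructor
      · rintro (ha | ha) _ ⟨f, hf, g, hg, σ, rfl⟩
        · rw [map_mul, ha f hf, zero_mul]
        · rw [map_mul, evalAt_smul, ha g hg, smul_zero, mul_zero]
      · intro ha
        by_contra hc
        simp only [Set.mem_union, not_or, zeroLocus, Set.mem_ofPred_eq, not_forall] at hc
        obtain ⟨⟨f, hf, hf0⟩, ⟨g, hg, hg0⟩⟩ := hc
        obtain ⟨σ, hσ⟩ := exists_mul_smul_ne_zero (G := G) hf0 hg0
        apply hσ
        rw [← evalAt_smul, ← map_mul]
        exact ha _ ⟨f, hf, g, hg, σ, rfl⟩)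

theorem isClosed_iff [IsPseudofield G A] {X : Set (DiffAffine G A n)} :
    IsClosed X ↔ IsPseudovariety X := by
  rw [← isOpen_compl_iff]
  change Xᶜᶜ ∈ {X | IsPseudovariety X} ↔ _
  rw [compl_compl]; rfl

/-- The ring `A{X}` of polynomial functions on `X`; by `coordinateRingEquiv` it is
`A{y₁, …, yₙ} / I(X)`. -/
noncomputable def coordinateRing (X : Set (DiffAffine G A n)) : Subalgebra A (X → A) :=
  (evalOn X).range

/-- The identification of `A{y₁, …, yₙ} / I(X)` with `A{X}`. -/
noncomputable def coordinateRingEquiv (X : Set (DiffAffine G A n)) :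
    (DiffPoly G A n ⧸ vanishingIdeal X) ≃ₐ[A] coordinateRing X :=
  Ideal.quotientKerEquivRange (evalOn X)

/-- The principal open subset `X_u` of `X`: the points at which `u` does not vanish. -/
def principalOpen {X : Set (DiffAffine G A n)} (u : coordinateRing X) : Set X :=
  {x | u.1 x ≠ 0}

/-- A function `f : X → A` is regular at `x` if, on a neighbourhood of `x` in `X`, it is a
quotient `h / g` of difference polynomials, `g` having invertible values there. -/
def IsRegularAt [IsPseudofield G A] {X : Set (DiffAffine G A n)} (f : X → A) (x : X) : Prop :=
  ∃ U : Set X, IsOpen U ∧ x ∈ U ∧ ∃ h g : DiffPoly G A n,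
    ∀ y ∈ U, IsUnit (evalAt y.1 g) ∧ f y * evalAt y.1 g = evalAt y.1 h

/-- A map into a subset of `A ^ n` is regular if its coordinate functions are regular at
every point. -/
def IsRegularMap [IsPseudofield G A] {Y : Set (DiffAffine G A m)} {X : Set (DiffAffine G A n)}
    (f : Y → X) : Prop :=
  ∀ i : Fin n, ∀ y : Y, IsRegularAt (fun z : Y => ((f z).1 i : A)) y

/-! ### The pull-back homomorphism -/

/-- A basic neighbourhood with a function that takes the value `1` at its centre. -/
theorem exists_eval_one [IsPseudofield G A] {X : Set (DiffAffine G A n)} {U : Set X}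
    (hU : IsOpen U) {x : X} (hx : x ∈ U) :
    ∃ q : DiffPoly G A n, evalAt x.1 q = 1 ∧ ∀ y : X, evalAt y.1 q ≠ 0 → y ∈ U := by
  obtain ⟨W, hW, rfl⟩ := isOpen_induced_iff.1 hU
  obtain ⟨E, hE⟩ := isClosed_iff.1 hW.isClosed_compl
  have hx' : x.1 ∉ zeroLocus E := by
    rw [← hE]; exact fun h => h hx
  simp only [zeroLocus, Set.mem_ofPred_eq, not_forall] at hx'
  obtain ⟨p, hpE, hp⟩ := hx'
  let I : Ideal A :=
    { carrier := {a | ∃ q : DiffPoly G A n, evalAt x.1 q = a ∧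
        ∀ y : DiffAffine G A n, evalAt y p = 0 → evalAt y q = 0}
      add_mem' := by
        rintro _ _ ⟨q, rfl, hq⟩ ⟨r, rfl, hr⟩
        exact ⟨q + r, map_add _ _ _, fun y hy => by rw [map_add, hq y hy, hr y hy, add_zero]⟩
      zero_mem' := ⟨0, map_zero _, fun _ _ => map_zero _⟩
      smul_mem' := by
        rintro c _ ⟨q, rfl, hq⟩
        exact ⟨c • q, map_smul _ _ _, fun y hy => by rw [map_smul, hq y hy, smul_zero]⟩ }
  have hI : IsDifferenceIdeal G I := by
    rintro σ _ ⟨q, rfl, hq⟩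
    exact ⟨σ • q, evalAt_smul _ _ _, fun y hy => by rw [evalAt_smul, hq y hy, smul_zero]⟩
  have htop : I = ⊤ := by
    refine (IsPseudofield.simple I hI).resolve_left fun h => hp ?_
    have : evalAt x.1 p ∈ I := ⟨p, rfl, fun _ h => h⟩
    rwa [h] at this
  obtain ⟨q, hq1, hq⟩ : (1 : A) ∈ I := htop ▸ Submodule.mem_top
  refine ⟨q, hq1, fun y hy => ?_⟩
  by_contra hyW
  have : y.1 ∈ zeroLocus E := by rw [← hE]; exact hyW
  exact hy (hq _ (this p hpE))

/-- A function which is regular on a pseudovariety over a difference closed pseudofield is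
polynomial. -/
theorem mem_coordinateRing_of_isRegular [Finite G] [IsDifferenceClosed G A]
    {X : Set (DiffAffine G A n)} (hX : IsPseudovariety X) {f : X → A}
    (hf : ∀ x, IsRegularAt f x) : f ∈ coordinateRing X := by
  classical
  letI := Fintype.ofFinite G
  have := IsPseudofield.nontrivial (G := G) (A := A)
  let J : Ideal (DiffPoly G A n) :=
    { carrier := {s | ∀ σ : G, ∃ h : DiffPoly G A n, ∀ y : X,
        f y * evalAt y.1 (σ • s) = evalAt y.1 h}
      add_mem' := by
        intro s t hs ht σ
        obtain ⟨h, hh⟩ := hs σ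
        obtain ⟨k, hk⟩ := ht σ
        exact ⟨h + k, fun y => by rw [smul_add, map_add, mul_add, hh, hk, map_add]⟩
      zero_mem' := fun σ => ⟨0, fun y => by rw [smul_zero, map_zero, mul_zero]⟩
      smul_mem' := by
        intro c s hs σ
        obtain ⟨h, hh⟩ := hs σ
        exact ⟨σ • c * h, fun y => by
          rw [smul_eq_mul, smul_mul', map_mul, map_mul, mul_left_comm, hh]⟩ }
  have hJ : IsDifferenceIdeal G J := by
    intro τ s hs σ
    obtain ⟨h, hh⟩ := hs (σ * τ)
    exact ⟨h, fun y => by rw [← mul_smul]; exact hh y⟩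
  have hempty : zeroLocus (J : Set (DiffPoly G A n)) = ∅ := by
    rw [Set.eq_empty_iff_forall_notMem]
    intro z hz
    obtain ⟨E, hE⟩ := hX
    have hzX : z ∈ X := by
      rw [hE]
      intro e he
      refine hz e fun σ => ⟨0, fun y => ?_⟩
      have hy : y.1 ∈ zeroLocus E := hE ▸ y.2
      rw [evalAt_smul, hy e he, smul_zero, mul_zero, map_zero]
    obtain ⟨U, hU, hzU, h, g, hgh⟩ := hf ⟨z, hzX⟩
    obtain ⟨q, hq1, hq⟩ := exists_eval_one hU hzU
    have hinv : ∀ (σ : G) (r : DiffPoly G A n), σ • ∏ τ : G, τ • r = ∏ τ : G, τ • r := by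
      intro σ r
      rw [Finset.smul_prod']
      simp_rw [← mul_smul]
      exact Fintype.prod_equiv (Equiv.mulLeft σ) _ _ fun _ => rfl
    let s : DiffPoly G A n := (∏ τ : G, τ • q) * ∏ τ : G, τ • g
    have hs : s ∈ J := by
      intro σ
      refine ⟨(∏ τ : G, τ • q) * (h * ∏ τ ∈ Finset.univ.erase (1 : G), τ • g), fun y => ?_⟩
      have h1 : σ • s = s := by
        change σ • (_ * _) = _
        rw [smul_mul', hinv, hinv]
      have h2 : ∏ τ : G, τ • g = g * ∏ τ ∈ Finset.univ.erase (1 : G), τ • g := by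
        rw [← Finset.mul_prod_erase Finset.univ (fun τ : G => τ • g) (Finset.mem_univ 1), one_smul]
      rw [h1]
      change f y * evalAt y.1 ((∏ τ : G, τ • q) * ∏ τ : G, τ • g) = _
      rw [h2]
      simp only [map_mul]
      by_cases hy : evalAt y.1 q = 0
      · have h3 : evalAt y.1 (∏ τ : G, τ • q) = 0 := by
          rw [map_prod]
          exact Finset.prod_eq_zero (Finset.mem_univ 1) (by rw [one_smul, hy])
        rw [h3]; ring
      · rw [← (hgh y (hq y hy)).2]; ring
    have h4 : IsUnit (evalAt z s) := by
      change IsUnit (evalAt z ((∏ τ : G, τ • q) * ∏ τ : G, τ • g))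
      have hg : IsUnit (evalAt z g) := (hgh ⟨z, hzX⟩ hzU).1
      have hq1' : evalAt z q = 1 := hq1
      rw [map_mul, map_prod, map_prod]
      simp only [evalAt_smul, hq1', smul_one, Finset.prod_const_one, one_mul]
      exact IsUnit.prod_iff.2 fun τ _ => hg.map (MulSemiringAction.toRingHom G A τ)
    exact h4.ne_zero (hz s hs)
  have h1 : (1 : DiffPoly G A n) ∈ J.radical := by
    rw [IsDifferenceClosed.radical_eq n J hJ, hempty]
    exact mem_vanishingIdeal.2 fun x hx => hx.elim
  have h2 : (1 : DiffPoly G A n) ∈ J := by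
    obtain ⟨k, hk⟩ := h1
    rwa [one_pow] at hk
  obtain ⟨h, hh⟩ := h2 1
  refine ⟨h, funext fun y => ?_⟩
  have h3 := hh y
  rw [one_smul, map_one, mul_one] at h3
  exact h3.symm

theorem comp_mem_coordinateRing [Finite G] [IsDifferenceClosed G A]
    {Y : Set (DiffAffine G A m)} {X : Set (DiffAffine G A n)} (hY : IsPseudovariety Y)
    {f : Y → X} (hf : IsRegularMap f) (u : coordinateRing X) :
    u.1 ∘ f ∈ coordinateRing Y := by
  have h : ∀ i, ∃ p : DiffPoly G A m, evalOn Y p = fun z : Y => ((f z).1 i : A) :=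
    fun i => mem_coordinateRing_of_isRegular hY (hf i)
  choose p hp using h
  obtain ⟨_, P, rfl⟩ := u
  let φ : DiffPoly G A n →ₐ[A] DiffPoly G A m :=
    MvPolynomial.aeval (fun q : G × Fin n => q.1 • p q.2)
  refine ⟨φ P, funext fun y => ?_⟩
  change evalAt y.1 (φ P) = evalAt (f y).1 P
  have : (evalAt y.1).toRingHom.comp φ.toRingHom = (evalAt (f y).1).toRingHom := by
    refine ringHom_ext (fun b => ?_) (fun q => ?_)
    · change evalAt y.1 (φ (algebraMap A _ b)) = evalAt (f y).1 (algebraMap A _ b)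
      simp only [AlgHom.commutes]
    · change evalAt y.1 (φ _) = evalAt (f y).1 _
      have hφ : φ (var q : DiffPoly G A n) = q.1 • p q.2 :=
        MvPolynomial.aeval_X _ _
      rw [hφ, evalAt_X, evalAt_smul]
      exact congrArg _ (congrFun (hp q.2) y)
  exact DFunLike.congr_fun this P

/-- The homomorphism `f^* : A{X} → A{Y}`, `u ↦ u ∘ f`, of a regular map `f : Y → X`. -/
noncomputable def pullback [Finite G] [IsDifferenceClosed G A]
    {Y : Set (DiffAffine G A m)} {X : Set (DiffAffine G A n)} (hY : IsPseudovariety Y)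
    (f : Y → X) (hf : IsRegularMap f) : coordinateRing X →ₐ[A] coordinateRing Y where
  toFun u := ⟨u.1 ∘ f, comp_mem_coordinateRing hY hf u⟩
  map_one' := rfl
  map_mul' _ _ := rfl
  map_zero' := rfl
  map_add' _ _ := rfl
  commutes' _ := rfl

/-- The restriction `Y_{f^*(u)} → X_u` of a regular map `f : Y → X`. -/
noncomputable def restrictPrincipal [Finite G] [IsDifferenceClosed G A]
    {Y : Set (DiffAffine G A m)} {X : Set (DiffAffine G A n)} (hY : IsPseudovariety Y)
    (f : Y → X) (hf : IsRegularMap f) (u : coordinateRing X) :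
    principalOpen (pullback hY f hf u) → principalOpen u :=
  fun y => ⟨f y.1, y.2⟩

end DiffGeom

open DiffGeom

/-!
Let `π : A → K` be a residue field of `A`. A point `x` of `A ^ n` is determined by the residues
`π (σ xᵢ)`, the coordinates of its residue point in the affine space `K ^ (G × n)`, because the
elements all of whose conjugates have residue zero form a difference ideal. Under this embedding the
topology of `A ^ n` is the Zariski topology (`isInducing_pointToPoint_residuePoint`): an equation
over `A` is a family of equations over `K`, one for each `σ`, and multiplication by an element that
annihilates exactly the kernel of `π` turns an equation over `K` into one over `A`. The difference
Nullstellensatz says that all closed points of the closure of a pseudovariety in this affine space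
are points of the pseudovariety (`exists_eq_vanishingIdeal_residuePoint`). Regular functions are
polynomial, so that `f` becomes a polynomial map, and the assertion becomes one about a morphism of
finite type between Noetherian affine schemes.

Such a morphism is generically open. Say that `f : R → S` is `GenericallyOpen` if every irreducible
closed subset of `Spec S` has a nonempty open part that is mapped openly to the closure of the image
of the subset. This property is stable under composition and holds for closed immersions and for the
projection of the affine line (`GenericallyOpen.polynomial_C`), where a proper irreducible subset of
the generic fibre is a hypersurface with monic equation after one element is inverted. Noetherian
induction on the source turns it into openness over a nonempty open subset of an irreducible
component of the target (`GenericallyOpen.exists_notMem_image_inter_basicOpen`). Finally, prime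
spectra are replaced by their rational points: the fibre over a closed point, intersected with an
open set, has a closed point as soon as it is nonempty, since polynomial rings over fields are
Jacobson.
-/

/-! ### Generic openness of morphisms of affine schemes -/

open PrimeSpectrum in
/-- A morphism of affine schemes, given by a ring homomorphism `f : R → S`, is generically open if
every irreducible closed subset `V(Q)` of `Spec S` has a nonempty open part `V(Q) ∩ D(b)` which is
mapped openly to the closure `V(f⁻¹ Q)` of the image of `V(Q)`. -/
def GenericallyOpen {R S : Type*} [CommRing R] [CommRing S] (f : R →+* S) : Prop :=
  ∀ Q : Ideal S, Q.IsPrime → ∃ b ∉ Q, ∀ O : Set (PrimeSpectrum S), IsOpen O →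
    ∃ O' : Set (PrimeSpectrum R), IsOpen O' ∧
      comap f '' (zeroLocus Q ∩ basicOpen b ∩ O) = zeroLocus (Q.comap f) ∩ O'

namespace GenericallyOpen

open PrimeSpectrum

theorem comp {R S T : Type*} [CommRing R] [CommRing S] [CommRing T] {f : R →+* S} {g : S →+* T}
    (hf : GenericallyOpen f) (hg : GenericallyOpen g) : GenericallyOpen (g.comp f) := by
  intro Q hQ
  obtain ⟨b, hb, hgb⟩ := hg Q hQ
  obtain ⟨c, hc, hfc⟩ := hf (Q.comap g) inferInstance
  refine ⟨b * g c, fun h => (hQ.mem_or_mem h).elim hb hc, fun O hO => ?_⟩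
  obtain ⟨O₁, hO₁, h₁⟩ := hgb O hO
  obtain ⟨O₂, hO₂, h₂⟩ := hfc O₁ hO₁
  refine ⟨O₂, hO₂, ?_⟩
  rw [← Ideal.comap_comap, ← h₂, Set.inter_right_comm (zeroLocus (Q.comap g : Set S)), ← h₁,
    ← Set.image_inter_preimage, comap_comp, Set.image_comp]
  congr 2
  ext x
  simp only [basicOpen_mul, Set.mem_inter_iff, Set.mem_preimage, SetLike.mem_coe,
    mem_basicOpen, comap_asIdeal, Ideal.mem_comap, TopologicalSpace.Opens.coe_inf]
  tauto

theorem of_surjective {R S : Type*} [CommRing R] [CommRing S] {f : R →+* S}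
    (hf : Function.Surjective f) : GenericallyOpen f := by
  intro Q hQ
  refine ⟨1, Q.one_notMem, fun O hO => ?_⟩
  obtain ⟨O', hO', rfl⟩ := (isClosedEmbedding_comap_of_surjective S f hf).isInducing.isOpen_iff.1 hO
  refine ⟨O', hO', ?_⟩
  rw [Set.image_inter_preimage, basicOpen_one, TopologicalSpace.Opens.coe_top, Set.inter_univ,
    image_comap_zeroLocus_eq_zeroLocus_comap _ _ hf]

end GenericallyOpen

namespace Polynomial

open PrimeSpectrum

/-- The part of a hypersurface `V(p)` of the affine line on which the leading coefficient of `p` is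
invertible is mapped openly to the base, because `p` becomes monic after inverting this
coefficient. -/
theorem isOpen_image_comap_C_zeroLocus_inter_basicOpen_leadingCoeff {R : Type*} [CommRing R]
    (p g : R[X]) :
    IsOpen (comap (C : R →+* R[X]) ''
      (zeroLocus {p} ∩ basicOpen (C p.leadingCoeff) ∩ basicOpen g)) := by
  rcases eq_or_ne p 0 with rfl | hp
  · simp
  set a := p.leadingCoeff with ha
  let B := Localization.Away a
  let φ : R[X] →+* B[X] := mapRingHom (algebraMap R B)
  let := φ.toAlgebra
  have hloc := Polynomial.isLocalization (.powers a) B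
  rw [Submonoid.map_powers] at hloc
  have hrange : Set.range (comap φ) = basicOpen (C a) := localization_away_comap_range B[X] (C a)
  obtain ⟨v, hv⟩ : IsUnit (algebraMap R B a) := IsLocalization.Away.algebraMap_isUnit a
  have hmonic : (C (↑v⁻¹ : B) * φ p).Monic := by
    rw [Monic.def, leadingCoeff_C_mul_of_isUnit v⁻¹.isUnit]
    rcases subsingleton_or_nontrivial B with h | h
    · exact Subsingleton.elim _ _
    · change _ * (p.map _).leadingCoeff = 1
      rw [leadingCoeff_map_of_leadingCoeff_ne_zero _ (by rw [← ha, ← hv]; exact v.ne_zero),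
        ← ha, ← hv, Units.inv_mul]
  have hzero : zeroLocus {C (↑v⁻¹ : B) * φ p} = zeroLocus {φ p} := by
    rw [← zeroLocus_span, ← zeroLocus_span {φ p},
      Ideal.span_singleton_mul_left_unit (v⁻¹.isUnit.map C)]
  have hset : zeroLocus {p} ∩ basicOpen (C a) ∩ basicOpen g =
      comap φ '' (zeroLocus {C (↑v⁻¹ : B) * φ p} \ zeroLocus {φ g}) := by
    rw [hzero, ← Set.image_singleton, ← Set.image_singleton (a := g), ← preimage_comap_zeroLocus,
      ← preimage_comap_zeroLocus, ← Set.preimage_sdiff, Set.image_preimage_eq_inter_range, hrange,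
      Set.inter_right_comm, Set.sdiff_eq, basicOpen_eq_zeroLocus_compl g]
  have hcomm : φ.comp C = C.comp (algebraMap R B) := by
    ext x; simp [φ]
  rw [hset, ← Set.image_comp, ← comap_comp, hcomm, comap_comp, Set.image_comp]
  exact (localization_away_isOpenEmbedding B a).isOpenMap _
    (isOpen_image_comap_of_monic _ _ hmonic)

/-- Pseudo-division by `p`: a prime of `R[X]` containing `p` and the constants of the ideal `P`,
but not the leading coefficient of `p`, contains `P` as soon as `p` has the least degree among the
members of `P` whose leading coefficient is not in `P`. -/
theorem le_of_forall_natDegree_le {R : Type*} [CommRing R] {P q : Ideal R[X]} (hq : q.IsPrime)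
    {p : R[X]} (hpP : p ∈ P) (hpq : p ∈ q) (hC : ∀ a : R, C a ∈ P → C a ∈ q)
    (hp : ∀ h ∈ P, C h.leadingCoeff ∉ P → p.natDegree ≤ h.natDegree ∧ C p.leadingCoeff ∉ q) :
    P ≤ q := by
  intro h
  induction hn : h.natDegree using Nat.strong_induction_on generalizing h with
  | _ n ih =>
    subst hn
    intro hhP
    rcases Nat.eq_zero_or_pos h.natDegree with h0 | hpos
    · rw [eq_C_of_natDegree_eq_zero h0] at hhP ⊢
      exact hC _ hhP
    by_cases hlc : C h.leadingCoeff ∈ P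
    · have hmem : h.eraseLead ∈ P := by
        rw [← self_sub_C_mul_X_pow]
        exact P.sub_mem hhP (P.mul_mem_right _ hlc)
      rw [← eraseLead_add_C_mul_X_pow h]
      refine q.add_mem (ih _ ?_ rfl hmem) (q.mul_mem_right _ (hC _ hlc))
      have := eraseLead_natDegree_le h
      omega
    · obtain ⟨hdeg, hpq'⟩ := hp h hhP hlc
      have hmem : p.cancelLeads h ∈ P :=
        P.sub_mem (P.mul_mem_left _ hhP) (P.mul_mem_left _ hpP)
      have hmem' := ih _ (natDegree_cancelLeads_lt_of_natDegree_le_natDegree hdeg hpos) rfl hmem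
      have : C p.leadingCoeff * h ∈ q := by
        have h2 := q.add_mem hmem' (q.mul_mem_left
          (C h.leadingCoeff * X ^ (h.natDegree - p.natDegree)) hpq)
        rwa [cancelLeads, sub_add_cancel, Nat.sub_eq_zero_of_le hdeg, pow_zero, mul_one] at h2
      exact (hq.mem_or_mem this).resolve_left hpq'

end Polynomial

namespace GenericallyOpen

open PrimeSpectrum

/-- A prime `P` of `R[X]` is either extended from `R`, and then the projection `V(P) → V(P ∩ R)` is
a base change of the affine line, or the fibre of `V(P)` over the generic point of `V(P ∩ R)` is
defined by one polynomial, of which a member of `P` of least degree is a representative. -/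
theorem polynomial_C (R : Type*) [CommRing R] :
    GenericallyOpen (Polynomial.C : R →+* Polynomial R) := by
  intro P hP
  by_cases hex : ∃ d, ∃ h ∈ P, Polynomial.C h.leadingCoeff ∉ P ∧ h.natDegree = d
  · classical
    obtain ⟨p, hpP, hpa, hpd⟩ := Nat.find_spec hex
    refine ⟨Polynomial.C p.leadingCoeff, hpa, fun O hO => ?_⟩
    refine ⟨comap Polynomial.C '' (zeroLocus {p} ∩ basicOpen (Polynomial.C p.leadingCoeff) ∩ O),
      ?_, ?_⟩
    · obtain ⟨T, hT, rfl⟩ := isTopologicalBasis_basic_opens.open_eq_sUnion hO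
      rw [Set.sUnion_eq_biUnion, Set.inter_iUnion₂, Set.image_iUnion₂]
      refine isOpen_biUnion fun t ht => ?_
      obtain ⟨g, rfl⟩ := hT ht
      exact Polynomial.isOpen_image_comap_C_zeroLocus_inter_basicOpen_leadingCoeff p g
    · have : zeroLocus (P : Set (Polynomial R)) ∩ basicOpen (Polynomial.C p.leadingCoeff) =
          comap Polynomial.C ⁻¹' zeroLocus (P.comap Polynomial.C) ∩
            (zeroLocus {p} ∩ basicOpen (Polynomial.C p.leadingCoeff)) := by
        ext q
        constructor
        · rintro ⟨hq, hqa⟩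
          exact ⟨fun a ha => hq ha, Set.singleton_subset_iff.2 (hq hpP), hqa⟩
        · rintro ⟨hq, hqp, hqa⟩
          refine ⟨?_, hqa⟩
          refine Polynomial.le_of_forall_natDegree_le q.2 hpP (Set.singleton_subset_iff.1 hqp)
            (fun a ha => hq ha) fun h hh hha => ⟨?_, hqa⟩
          rw [hpd]
          exact Nat.find_min' hex ⟨h, hh, hha, rfl⟩
      rw [this, Set.inter_assoc, Set.image_preimage_inter]
  · push Not at hex
    refine ⟨1, P.one_notMem, fun O hO => ⟨_, Polynomial.isOpenMap_comap_C O hO, ?_⟩⟩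
    have : zeroLocus (P : Set (Polynomial R)) =
        comap Polynomial.C ⁻¹' zeroLocus (P.comap Polynomial.C) := by
      ext q
      refine ⟨fun hq a ha => hq ha, fun hq => ?_⟩
      exact Polynomial.le_of_forall_natDegree_le q.2 P.zero_mem q.asIdeal.zero_mem
        (fun a ha => hq ha) fun h hh hha => (hex _ h hh hha rfl).elim
    rw [basicOpen_one, TopologicalSpace.Opens.coe_top, Set.inter_univ, this,
      Set.image_preimage_inter]

theorem of_finitePresentation {R S : Type*} [CommRing R] [CommRing S] {f : R →+* S}
    (hf : f.FinitePresentation) : GenericallyOpen f :=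
  RingHom.FinitePresentation.polynomial_induction
    (fun _ _ _ _ => GenericallyOpen) (fun _ _ _ _ => GenericallyOpen)
    (fun R _ => polynomial_C R) (fun _ _ _ _ _ h _ => of_surjective h)
    (fun _ _ _ _ _ _ _ _ h₁ h₂ => h₁.comp h₂) f hf

/-- Over a nonempty open subset `V(p) ∩ D(r)` of an irreducible component `V(p)` of `V(J)`, a
generically open map sends the open subsets of any closed subset `V(I)` lying over `V(J)` to open
subsets of `V(J)`. Noetherian induction on `V(I)` reduces this to an irreducible `V(I)` that
dominates `V(p)`; there the part `V(I) ∩ D(b)` is mapped openly and the rest is a smaller closed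
subset. -/
theorem exists_notMem_image_inter_basicOpen {R S : Type*} [CommRing R] [CommRing S]
    [IsNoetherianRing R] [IsNoetherianRing S] {f : R →+* S} (hf : GenericallyOpen f)
    {J p : Ideal R} (hp : p ∈ J.minimalPrimes) (I : Ideal S) (hI : J ≤ I.comap f) :
    ∃ r ∉ p, ∀ O : Set (PrimeSpectrum S), IsOpen O → ∃ O' : Set (PrimeSpectrum R), IsOpen O' ∧
      comap f '' (zeroLocus I ∩ O) ∩ basicOpen r = zeroLocus J ∩ O' ∩ basicOpen r := by
  have hpp : p.IsPrime := hp.1.1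
  -- `r₀` vanishes on the other irreducible components of `V(J)`, so `V(J) ∩ D(r₀) ⊆ V(p)`.
  obtain ⟨r₀, hr₀, hJp⟩ : ∃ r₀ ∉ p, ∀ x ∈ zeroLocus (J : Set R), r₀ ∉ x.asIdeal →
      p ≤ x.asIdeal := by
    have hfin : (J.minimalPrimes \ {p}).Finite := J.finite_minimalPrimes_of_isNoetherianRing.sdiff
    have hnot : ¬ hfin.toFinset.inf id ≤ p := by
      rw [hpp.inf_le']
      rintro ⟨p', hp', hle⟩
      rw [Set.Finite.mem_toFinset] at hp'
      exact hp'.2 (le_antisymm hle (hp.2 hp'.1.1 hle))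
    obtain ⟨r₀, hr₀, hr₀p⟩ := SetLike.not_le_iff_exists.1 hnot
    refine ⟨r₀, hr₀p, fun x hx hxr => ?_⟩
    obtain ⟨p', hp', hle⟩ := Ideal.exists_minimalPrimes_le (J := x.asIdeal) (I := J) hx
    by_cases h : p' = p
    · exact h ▸ hle
    · refine (hxr (hle ?_)).elim
      exact (Submodule.mem_finsetInf.1 hr₀) p' (by simpa using ⟨hp', h⟩)
  induction I using WellFoundedGT.induction with
  | ind I ih =>
    by_cases htop : I = ⊤
    · exact ⟨1, p.one_notMem, fun O _ => ⟨∅, isOpen_empty, by simp [htop]⟩⟩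
    by_cases hIp : I.IsPrime
    · by_cases hle : I.comap f ≤ p
      · obtain ⟨b, hb, hbO⟩ := hf I hIp
        obtain ⟨r₁, hr₁, h₁⟩ := ih (I ⊔ Ideal.span {b})
          (lt_of_le_of_ne le_sup_left fun h => hb (h ▸ Ideal.mem_sup_right
            (Ideal.mem_span_singleton_self b))) (hI.trans (Ideal.comap_mono le_sup_left))
        have heq : I.comap f = p := le_antisymm hle (hp.2 ⟨inferInstance, hI⟩ hle)
        refine ⟨r₀ * r₁, fun h => (hpp.mem_or_mem h).elim hr₀ hr₁, fun O hO => ?_⟩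
        obtain ⟨O₂, hO₂, h₂⟩ := hbO O hO
        obtain ⟨O₁, hO₁, h₁⟩ := h₁ O hO
        refine ⟨O₂ ∪ O₁, hO₂.union hO₁, ?_⟩
        have hsplit : zeroLocus (I : Set S) ∩ O =
            (zeroLocus I ∩ basicOpen b ∩ O) ∪ (zeroLocus (I ⊔ Ideal.span {b} : Ideal S) ∩ O) := by
          rw [zeroLocus_sup, zeroLocus_span, ← Set.union_inter_distrib_right,
            ← Set.inter_union_distrib_left, basicOpen_eq_zeroLocus_compl, Set.compl_union_self,
            Set.inter_univ]
        rw [hsplit, Set.image_union, h₂, heq]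
        ext x
        have h₁x := Set.ext_iff.1 h₁ x
        have hJx : r₀ ∉ x.asIdeal → (x ∈ zeroLocus (J : Set R) ↔ x ∈ zeroLocus (p : Set R)) :=
          fun h => ⟨fun hx => hJp x hx h, fun hx => hp.1.2.trans hx⟩
        simp only [basicOpen_mul, TopologicalSpace.Opens.coe_inf, Set.mem_inter_iff, Set.mem_union,
          SetLike.mem_coe, mem_basicOpen] at h₁x ⊢
        tauto
      · -- The image of `V(I)` lies in a closed set that does not contain `V(p)`.
        obtain ⟨r, hr, hrp⟩ := SetLike.not_le_iff_exists.1 hle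
        refine ⟨r, hrp, fun O _ => ⟨∅, isOpen_empty, ?_⟩⟩
        rw [Set.inter_empty, Set.empty_inter, Set.eq_empty_iff_forall_notMem]
        rintro _ ⟨⟨x, ⟨hx, -⟩, rfl⟩, hxr⟩
        exact hxr (hx hr)
    · -- Here `V(I)` is the union of two smaller closed sets.
      obtain ⟨x, hx, y, hy, hxy⟩ := (Ideal.not_isPrime_iff.1 hIp).resolve_left htop
      have key : ∀ z ∉ I, I < I ⊔ Ideal.span {z} := fun z hz =>
        lt_of_le_of_ne le_sup_left fun h => hz (h ▸ Ideal.mem_sup_right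
          (Ideal.mem_span_singleton_self z))
      obtain ⟨r₁, hr₁, h₁⟩ := ih _ (key x hx) (hI.trans (Ideal.comap_mono le_sup_left))
      obtain ⟨r₂, hr₂, h₂⟩ := ih _ (key y hy) (hI.trans (Ideal.comap_mono le_sup_left))
      refine ⟨r₁ * r₂, fun h => (hpp.mem_or_mem h).elim hr₁ hr₂, fun O hO => ?_⟩
      obtain ⟨O₁, hO₁, h₁⟩ := h₁ O hO
      obtain ⟨O₂, hO₂, h₂⟩ := h₂ O hO
      refine ⟨O₁ ∪ O₂, hO₁.union hO₂, ?_⟩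
      have hsplit : zeroLocus (I : Set S) ∩ O =
          (zeroLocus (I ⊔ Ideal.span {x} : Ideal S) ∩ O) ∪
            (zeroLocus (I ⊔ Ideal.span {y} : Ideal S) ∩ O) := by
        rw [← Set.union_inter_distrib_right, zeroLocus_sup, zeroLocus_sup, zeroLocus_span,
          zeroLocus_span, ← Set.inter_union_distrib_left, ← zeroLocus_singleton_mul,
          Set.inter_eq_left.2 (zeroLocus_anti_mono (Set.singleton_subset_iff.2 hxy))]
      rw [hsplit, Set.image_union]
      rw [basicOpen_mul, TopologicalSpace.Opens.coe_inf, Set.union_inter_distrib_right,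
        ← Set.inter_assoc, h₁, Set.inter_comm (basicOpen r₁ : Set (PrimeSpectrum R)),
        ← Set.inter_assoc (comap f '' _), h₂]
      ext z
      simp only [Set.mem_inter_iff, Set.mem_union]
      tauto

end GenericallyOpen

/-! ### Rational points -/

open PrimeSpectrum MvPolynomial in
/-- The generic openness of a morphism of affine schemes, transferred to sets of rational points.
The hypothesis `hpoint` says that all closed points of the closure of `Y` are points of `Y`: it supplies
a preimage in `Y` of a point of `X` whose fibre meets the given open set. -/
theorem MvPolynomial.exists_forall_isOpen_image_points {K ι κ : Type*} [Field K] [Finite ι]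
    [Finite κ] {X : Set (ι → K)} {Y : Set (κ → K)} (hX : X.Nonempty)
    (F : ι → MvPolynomial κ K) (hF : ∀ y ∈ Y, (fun i => aeval y (F i)) ∈ X)
    (hpoint : ∀ M : Ideal (MvPolynomial κ K), M.IsMaximal → MvPolynomial.vanishingIdeal K Y ≤ M →
      ∃ y ∈ Y, M = MvPolynomial.vanishingIdeal K {y}) :
    ∃ r : MvPolynomial ι K, (∃ x ∈ X, aeval x r ≠ 0) ∧
      ∀ O : Set (PrimeSpectrum (MvPolynomial κ K)), IsOpen O →
        ∃ O' : Set (PrimeSpectrum (MvPolynomial ι K)), IsOpen O' ∧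
          ∀ x ∈ X, aeval x r ≠ 0 →
            (pointToPoint x ∈ O' ↔ ∃ y ∈ Y, pointToPoint y ∈ O ∧ (fun i => aeval y (F i)) = x) := by
  let φ : MvPolynomial ι K →ₐ[K] MvPolynomial κ K := aeval F
  have hφ : ∀ (y : κ → K) (t : MvPolynomial ι K),
      aeval y (φ t) = aeval (fun i => aeval y (F i)) t := fun y t => by
    rw [← AlgHom.comp_apply]
    congr 1
    ext i
    simp [φ]
  have hfp : φ.toRingHom.FinitePresentation := by
    refine RingHom.FinitePresentation.of_finiteType.1 ?_
    refine RingHom.FiniteType.of_comp_finiteType (f := C) ?_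
    have : φ.toRingHom.comp C = C := by ext; simp [φ]
    rw [this]
    exact RingHom.finiteType_algebraMap.2
      (inferInstanceAs (Algebra.FiniteType K (MvPolynomial κ K)))
  obtain ⟨x₀, hx₀⟩ := hX
  have hne : MvPolynomial.vanishingIdeal K X ≠ ⊤ := fun h => by
    have : (1 : MvPolynomial ι K) ∈ MvPolynomial.vanishingIdeal K X := h ▸ Submodule.mem_top
    simpa using this x₀ hx₀
  obtain ⟨p, hp⟩ := Ideal.nonempty_minimalPrimes hne
  obtain ⟨r, hr, hrO⟩ :=
    (GenericallyOpen.of_finitePresentation hfp).exists_notMem_image_inter_basicOpen hp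
      (MvPolynomial.vanishingIdeal K Y) fun t ht y hy => (hφ y t).trans (ht _ (hF y hy))
  have hcomap : ∀ y : κ → K, PrimeSpectrum.comap φ.toRingHom (pointToPoint y) =
      (pointToPoint (fun i => aeval y (F i)) : PrimeSpectrum (MvPolynomial ι K)) := fun y => by
    refine PrimeSpectrum.ext (Ideal.ext fun t => ?_)
    change φ t ∈ MvPolynomial.vanishingIdeal K {y} ↔
      t ∈ MvPolynomial.vanishingIdeal K {fun i => aeval y (F i)}
    rw [mem_vanishingIdeal_singleton_iff, mem_vanishingIdeal_singleton_iff, hφ]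
  refine ⟨r, ?_, fun O hO => ?_⟩
  · by_contra! h
    exact hr (hp.1.2 h)
  obtain ⟨O', hO', h⟩ := hrO O hO
  refine ⟨O', hO', fun x hx hxr => ⟨fun hxO => ?_, ?_⟩⟩
  · have hxJ : pointToPoint x ∈ PrimeSpectrum.zeroLocus
        (MvPolynomial.vanishingIdeal K X : Set (MvPolynomial ι K)) :=
      fun t ht => (mem_vanishingIdeal_singleton_iff x t).2 (ht x hx)
    have hxr' : (pointToPoint x : PrimeSpectrum (MvPolynomial ι K)) ∈ basicOpen r :=
      fun hr => hxr ((mem_vanishingIdeal_singleton_iff x r).1 hr)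
    obtain ⟨⟨q, ⟨hqI, hqO⟩, hq⟩, -⟩ := h.symm.subset ⟨⟨hxJ, hxO⟩, hxr'⟩
    have hxmax : (pointToPoint x : PrimeSpectrum (MvPolynomial ι K)).asIdeal.IsMaximal :=
      inferInstanceAs (MvPolynomial.vanishingIdeal K {x}).IsMaximal
    -- The fibre over the closed point `x` is closed, so its trace on `V(I) ∩ O` has a closed point.
    obtain ⟨M, ⟨⟨hMI, hMx⟩, hMO⟩, hM⟩ := nonempty_inter_closedPoints
      (Z := PrimeSpectrum.zeroLocus (MvPolynomial.vanishingIdeal K Y : Set (MvPolynomial κ K)) ∩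
        PrimeSpectrum.comap φ.toRingHom ⁻¹' {pointToPoint x} ∩ O) ⟨q, ⟨hqI, hq⟩, hqO⟩
      ((((isClosed_zeroLocus _).inter (((isClosed_singleton_iff_isMaximal _).2 hxmax).preimage
        (PrimeSpectrum.continuous_comap _))).isLocallyClosed).inter hO.isLocallyClosed)
    obtain ⟨y, hyY, hMy⟩ := hpoint M.asIdeal ((isClosed_singleton_iff_isMaximal M).1 hM) hMI
    obtain rfl : M = pointToPoint y := PrimeSpectrum.ext hMy
    refine ⟨y, hyY, hMO, ?_⟩
    funext i
    have hyx : pointToPoint (fun i => aeval y (F i)) = pointToPoint x := (hcomap y).symm.trans hMx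
    have : (MvPolynomial.X i - C (x i) : MvPolynomial ι K) ∈ (pointToPoint x).asIdeal :=
      (mem_vanishingIdeal_singleton_iff x _).2 (by simp)
    rw [← hyx] at this
    have := (mem_vanishingIdeal_singleton_iff _ _).1 this
    simpa [sub_eq_zero] using this
  · rintro ⟨y, hy, hyO, rfl⟩
    have hyr : (pointToPoint (fun i => aeval y (F i)) : PrimeSpectrum (MvPolynomial ι K)) ∈
        basicOpen r := fun hr => hxr ((mem_vanishingIdeal_singleton_iff _ r).1 hr)
    refine (h.subset ⟨⟨pointToPoint y, ⟨?_, hyO⟩, hcomap y⟩, hyr⟩).1.2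
    exact fun t ht => (mem_vanishingIdeal_singleton_iff y t).2 (ht y hy)

/-! ### The affine space over a residue field of a pseudofield -/

namespace DiffGeom

variable {G : Type*} {A : Type*} [CommRing A] {n : ℕ} {K : Type*} [Field K]

/-- Reduction of the coefficients of a difference polynomial. -/
noncomputable def reduce (π : A →+* K) : DiffPoly G A n →+* MvPolynomial (G × Fin n) K :=
  MvPolynomial.map π

theorem reduce_surjective {π : A →+* K} (hπ : Function.Surjective π) :
    Function.Surjective (reduce (G := G) (n := n) π) :=
  MvPolynomial.map_surjective π hπ

theorem reduce_algebraMap (π : A →+* K) (a : A) :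
    reduce π (algebraMap A (DiffPoly G A n) a) = MvPolynomial.C (π a) :=
  MvPolynomial.map_C π a

variable [Group G] [MulSemiringAction G A]

/-- The point of the affine space over a residue field `π : A → K` that corresponds to a point `x`
of `A ^ n`: its coordinate with index `(σ, i)` is the residue of `σ xᵢ`. -/
def residuePoint (π : A →+* K) (x : DiffAffine G A n) : G × Fin n → K :=
  fun p => π (p.1 • (x p.2 : A))

theorem aeval_residuePoint_reduce (π : A →+* K) (x : DiffAffine G A n) (P : DiffPoly G A n) :
    MvPolynomial.aeval (residuePoint π x) (reduce π P) = π (DiffPoly.evalAt x P) := by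
  have : (MvPolynomial.aeval (residuePoint π x)).toRingHom.comp (reduce π) =
      π.comp (DiffPoly.evalAt x).toRingHom := by
    refine DiffPoly.ringHom_ext (fun a => ?_) fun p => ?_
    · change MvPolynomial.aeval _ (reduce π (algebraMap A _ a)) =
        π (DiffPoly.evalAt x (algebraMap A _ a))
      rw [reduce_algebraMap, AlgHom.commutes, MvPolynomial.aeval_C]
      rfl
    · change MvPolynomial.aeval _ (MvPolynomial.map π (MvPolynomial.X p)) =
        π (DiffPoly.evalAt x (DiffPoly.var p))
      rw [MvPolynomial.map_X, MvPolynomial.aeval_X, DiffPoly.evalAt_X]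
      rfl
  exact DFunLike.congr_fun this P

/-- The elements all of whose conjugates have residue zero form a proper difference ideal. -/
theorem eq_zero_of_forall_map_smul_eq_zero [IsPseudofield G A] (π : A →+* K) {a : A}
    (h : ∀ σ : G, π (σ • a) = 0) : a = 0 := by
  let I : Ideal A := ⨅ σ : G, (RingHom.ker π).comap (MulSemiringAction.toRingHom G A σ)
  have hmem : ∀ b, b ∈ I ↔ ∀ σ : G, π (σ • b) = 0 := fun b => by
    simp [I, Ideal.mem_comap, RingHom.mem_ker]
  have hI : IsDifferenceIdeal G I := fun τ b hb => (hmem _).2 fun σ => by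
    rw [← mul_smul]
    exact (hmem b).1 hb _
  rcases IsPseudofield.simple I hI with h0 | h1
  · simpa [h0] using (hmem a).2 h
  · have : (1 : A) ∈ I := h1 ▸ Submodule.mem_top
    simpa using (hmem 1).1 this 1

theorem residuePoint_injective [IsPseudofield G A] (π : A →+* K) :
    Function.Injective (residuePoint π : DiffAffine G A n → _) := by
  intro x y h
  funext i
  refine sub_eq_zero.1 (eq_zero_of_forall_map_smul_eq_zero (G := G) π fun σ => ?_)
  rw [smul_sub, map_sub, sub_eq_zero]
  exact congrFun h (σ, i)

/-- If the conjugate by `σ` of the kernel of a residue map is contained in this kernel, then the two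
are equal. -/
theorem map_eq_zero_of_forall_map_smul_eq_zero_imp {π : A →+* K} (hπ : Function.Surjective π)
    {σ : G} (h : ∀ a, π (σ • a) = 0 → π a = 0) {a : A} (ha : π a = 0) : π (σ • a) = 0 := by
  have h1 : (RingHom.ker (π.comp (MulSemiringAction.toRingHom G A σ))).IsMaximal :=
    RingHom.ker_isMaximal_of_surjective _
      (hπ.comp (MulAction.surjective σ))
  have h2 := h1.eq_of_le (RingHom.ker_ne_top π) fun b hb => h b hb
  have h3 : a ∈ RingHom.ker π := ha
  rw [← h2] at h3
  exact h3

/-- A pseudofield is the product of finitely many fields permuted by the group. Multiplication by a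
suitable `c` annihilates all factors but the one with residue map `π`, so that the vanishing of a
residue becomes an equation over the pseudofield. -/
theorem exists_forall_mul_eq_zero_iff [Finite G] [IsPseudofield G A] {π : A →+* K}
    (hπ : Function.Surjective π) : ∃ c : A, ∀ a, c * a = 0 ↔ π a = 0 := by
  have : ∀ σ : G, ∃ c : A, π c ≠ 0 ∧ ∀ a, π a = 0 → π (σ • (c * a)) = 0 := by
    intro σ
    by_cases h : ∀ a, π (σ • a) = 0 → π a = 0
    · refine ⟨1, by simp, fun a ha => ?_⟩
      rw [one_mul]
      exact map_eq_zero_of_forall_map_smul_eq_zero_imp hπ h ha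
    · push Not at h
      obtain ⟨c, hc, hc0⟩ := h
      exact ⟨c, hc0, fun a _ => by rw [smul_mul', map_mul, hc, zero_mul]⟩
  choose c hc hca using this
  have := Fintype.ofFinite G
  classical
  refine ⟨∏ σ, c σ, fun a => ⟨fun h => ?_, fun h => ?_⟩⟩
  · have := congrArg π h
    rw [map_mul, map_zero, map_prod] at this
    exact (mul_eq_zero.1 this).resolve_left (Finset.prod_ne_zero_iff.2 fun σ _ => hc σ)
  · refine eq_zero_of_forall_map_smul_eq_zero (G := G) π fun σ => ?_
    rw [← Finset.mul_prod_erase _ _ (Finset.mem_univ σ), mul_right_comm, smul_mul', map_mul,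
      hca σ a h, zero_mul]

/-- The topology of `A ^ n` is the Zariski topology of the affine space over a residue field. -/
theorem isInducing_pointToPoint_residuePoint [Finite G] [IsPseudofield G A] {π : A →+* K}
    (hπ : Function.Surjective π) :
    Topology.IsInducing fun x : DiffAffine G A n =>
      (MvPolynomial.pointToPoint (residuePoint π x) :
        PrimeSpectrum (MvPolynomial (G × Fin n) K)) := by
  refine ⟨TopologicalSpace.ext_isClosed fun Z => ?_⟩
  rw [isClosed_iff, isClosed_induced_iff]
  constructor
  · rintro ⟨E, rfl⟩
    refine ⟨PrimeSpectrum.zeroLocus {t | ∃ e ∈ E, ∃ σ : G, reduce π (σ • e) = t},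
      PrimeSpectrum.isClosed_zeroLocus _, ?_⟩
    ext x
    constructor
    · intro hx e he
      refine eq_zero_of_forall_map_smul_eq_zero (G := G) π fun σ => ?_
      have := (MvPolynomial.mem_vanishingIdeal_singleton_iff _ _).1 (hx ⟨e, he, σ, rfl⟩)
      rwa [aeval_residuePoint_reduce, DiffPoly.evalAt_smul] at this
    · rintro hx _ ⟨e, he, σ, rfl⟩
      refine (MvPolynomial.mem_vanishingIdeal_singleton_iff _ _).2 ?_
      rw [aeval_residuePoint_reduce, DiffPoly.evalAt_smul, hx e he, smul_zero, map_zero]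
  · rintro ⟨T, hT, rfl⟩
    obtain ⟨T, rfl⟩ := (PrimeSpectrum.isClosed_iff_zeroLocus _).1 hT
    obtain ⟨c, hc⟩ := exists_forall_mul_eq_zero_iff (G := G) hπ
    refine ⟨{e | ∃ P : DiffPoly G A n, reduce π P ∈ T ∧ e = c • P}, ?_⟩
    ext x
    constructor
    · rintro hx _ ⟨P, hP, rfl⟩
      rw [map_smul, smul_eq_mul, hc, ← aeval_residuePoint_reduce]
      exact (MvPolynomial.mem_vanishingIdeal_singleton_iff _ _).1 (hx hP)
    · intro hx t ht
      obtain ⟨P, rfl⟩ := reduce_surjective hπ t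
      refine (MvPolynomial.mem_vanishingIdeal_singleton_iff _ _).2 ?_
      have := hx _ ⟨P, ht, rfl⟩
      rwa [map_smul, smul_eq_mul, hc, ← aeval_residuePoint_reduce] at this

/-- The difference Nullstellensatz in terms of a residue field: the closed points of the closure of
a pseudovariety are points of the pseudovariety. -/
theorem exists_eq_vanishingIdeal_residuePoint [Finite G] [IsDifferenceClosed G A] {π : A →+* K}
    (hπ : Function.Surjective π) {Y : Set (DiffAffine G A n)} (hY : IsPseudovariety Y)
    (M : Ideal (MvPolynomial (G × Fin n) K)) (hM : M.IsMaximal)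
    (hYM : MvPolynomial.vanishingIdeal K (residuePoint π '' Y) ≤ M) :
    ∃ y ∈ residuePoint π '' Y, M = MvPolynomial.vanishingIdeal K {y} := by
  let N : Ideal (DiffPoly G A n) := M.comap (reduce π)
  -- The largest difference ideal contained in the preimage of `M` has a zero `y`.
  let f : G → Ideal (DiffPoly G A n) := fun σ => N.comap (DiffPoly.act σ)
  let I : Ideal (DiffPoly G A n) := ⨅ σ : G, f σ
  have hmem : ∀ P, P ∈ I ↔ ∀ σ : G, reduce π (σ • P) ∈ M := fun P => by
    simp only [I, Ideal.mem_iInf]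
    rfl
  have hI : IsDifferenceIdeal G I := fun τ P hP => (hmem _).2 fun σ => by
    rw [← mul_smul]
    exact (hmem P).1 hP _
  have hI1 : (1 : DiffPoly G A n) ∉ I.radical := by
    rintro ⟨k, hk⟩
    rw [one_pow, hmem] at hk
    have := hk 1
    rw [one_smul, map_one] at this
    exact hM.ne_top (M.eq_top_of_isUnit_mem this isUnit_one)
  rw [IsDifferenceClosed.radical_eq n I hI, mem_vanishingIdeal] at hI1
  push Not at hI1
  obtain ⟨y, hy, -⟩ := hI1
  -- One of the conjugates of `N` is contained in the ideal of `y`.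
  obtain ⟨σ, hσ⟩ : ∃ σ : G, f σ ≤ RingHom.ker (π.comp (DiffPoly.evalAt y).toRingHom) := by
    have := Fintype.ofFinite G
    have hprime := RingHom.ker_isPrime (π.comp (DiffPoly.evalAt y).toRingHom)
    have hle : Finset.univ.inf f ≤ RingHom.ker (π.comp (DiffPoly.evalAt y).toRingHom) := by
      intro P hP
      have : DiffPoly.evalAt y P = 0 := hy P (by
        rw [SetLike.mem_coe, Ideal.mem_iInf]
        exact fun σ => (Submodule.mem_finsetInf.1 hP) σ (Finset.mem_univ σ))
      rw [RingHom.mem_ker]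
      change π (DiffPoly.evalAt y P) = 0
      rw [this, map_zero]
    obtain ⟨σ, -, h⟩ := hprime.inf_le'.1 hle
    exact ⟨σ, h⟩
  have hσ' : ∀ P : DiffPoly G A n, reduce π P ∈ M → π (σ⁻¹ • DiffPoly.evalAt y P) = 0 := by
    intro P hP
    rw [← DiffPoly.evalAt_smul]
    refine hσ ?_
    change reduce π (σ • σ⁻¹ • P) ∈ M
    rwa [smul_inv_smul]
  -- Evaluation at the constants shows that `σ` fixes the kernel of `π`.
  have hker : ∀ a, π a = 0 → π (σ⁻¹ • a) = 0 := fun a ha => by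
    have := hσ' (algebraMap A _ a) (by
      rw [reduce_algebraMap, ha, map_zero]
      exact M.zero_mem)
    rwa [AlgHom.commutes] at this
  have hle : M ≤ MvPolynomial.vanishingIdeal K {residuePoint π y} := by
    intro t ht
    obtain ⟨P, rfl⟩ := reduce_surjective hπ t
    rw [MvPolynomial.mem_vanishingIdeal_singleton_iff, aeval_residuePoint_reduce]
    have := map_eq_zero_of_forall_map_smul_eq_zero_imp hπ (σ := σ) (fun a ha => by
      simpa using hker _ ha) (hσ' P ht)
    rwa [smul_inv_smul] at this
  have hM' := hM.eq_of_le (Ideal.IsPrime.ne_top inferInstance) hle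
  refine ⟨_, ⟨y, ?_, rfl⟩, hM'⟩
  obtain ⟨E, rfl⟩ := hY
  intro e he
  refine eq_zero_of_forall_map_smul_eq_zero (G := G) π fun τ => ?_
  rw [← DiffPoly.evalAt_smul, ← aeval_residuePoint_reduce,
    ← MvPolynomial.mem_vanishingIdeal_singleton_iff, ← hM']
  refine hYM ?_
  rintro _ ⟨x, hx, rfl⟩
  rw [aeval_residuePoint_reduce, DiffPoly.evalAt_smul, hx e he, smul_zero, map_zero]

end DiffGeom

/-! ### Generic openness of regular maps -/

theorem mainTheorem6 {G : Type*} [Group G] [Finite G] {A : Type*} [CommRing A]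
    [MulSemiringAction G A] [IsDifferenceClosed G A] {m n : ℕ}
    {Y : Set (DiffAffine G A m)} {X : Set (DiffAffine G A n)}
    (hY : IsPseudovariety Y) (hX : IsPseudovariety X)
    (f : Y → X) (hf : IsRegularMap f) (hdense : DenseRange f) :
    ∃ u : coordinateRing X, (X.Nonempty → (principalOpen u).Nonempty) ∧
      IsOpenMap (restrictPrincipal hY f hf u) := by
  rcases X.eq_empty_or_nonempty with rfl | hne
  · exact ⟨0, fun h => (Set.not_nonempty_empty h).elim, fun _ _ =>
      isOpen_iff_mem_nhds.2 fun x => x.1.2.elim⟩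
  have := IsPseudofield.nontrivial (G := G) (A := A)
  obtain ⟨𝔪, h𝔪⟩ := Ideal.exists_maximal A
  let := Ideal.Quotient.field 𝔪
  let π : A →+* A ⧸ 𝔪 := Ideal.Quotient.mk 𝔪
  have hπ : Function.Surjective π := Ideal.Quotient.mk_surjective
  have hp : ∀ i, ∃ p : DiffPoly G A m, evalOn Y p = fun z : Y => ((f z).1 i : A) :=
    fun i => mem_coordinateRing_of_isRegular hY (hf i)
  choose p hp using hp
  let F : G × Fin n → MvPolynomial (G × Fin m) (A ⧸ 𝔪) := fun q => reduce π (q.1 • p q.2)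
  have hF : ∀ y : Y, (fun q => MvPolynomial.aeval (residuePoint π y.1) (F q)) =
      residuePoint π (f y).1 := fun y => by
    funext q
    rw [aeval_residuePoint_reduce, DiffPoly.evalAt_smul]
    exact congrArg (fun a => π (q.1 • a)) (congrFun (hp q.2) y)
  obtain ⟨r, ⟨_, ⟨x₀, hx₀, rfl⟩, hrx₀⟩, hrO⟩ :=
    MvPolynomial.exists_forall_isOpen_image_points (X := residuePoint π '' X)
      (Y := residuePoint π '' Y) (hne.image _) F
      (by rintro _ ⟨y, hy, rfl⟩; exact hF ⟨y, hy⟩ ▸ ⟨_, (f ⟨y, hy⟩).2, rfl⟩)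
      (exists_eq_vanishingIdeal_residuePoint hπ hY)
  have hindX := isInducing_pointToPoint_residuePoint (n := n) (G := G) hπ
  have hindY := isInducing_pointToPoint_residuePoint (n := m) (G := G) hπ
  -- Shrink the open set over which the map is open to a principal open subset of `X`.
  have hUopen : IsOpen {x : X | MvPolynomial.aeval (residuePoint π x.1) r ≠ 0} := by
    have : {x : X | MvPolynomial.aeval (residuePoint π x.1) r ≠ 0} =
        (fun x : X => MvPolynomial.pointToPoint (residuePoint π x.1)) ⁻¹'
          (PrimeSpectrum.basicOpen r : Set (PrimeSpectrum (MvPolynomial (G × Fin n) (A ⧸ 𝔪)))) := by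
      ext x
      exact not_congr (MvPolynomial.mem_vanishingIdeal_singleton_iff _ _).symm
    rw [this]
    exact (PrimeSpectrum.basicOpen r).2.preimage (hindX.continuous.comp continuous_subtype_val)
  obtain ⟨q, hq1, hq⟩ := exists_eval_one hUopen (x := ⟨x₀, hx₀⟩) hrx₀
  refine ⟨⟨evalOn X q, q, rfl⟩, fun _ => ⟨⟨x₀, hx₀⟩, ?_⟩, fun V hV => ?_⟩
  · change DiffPoly.evalAt x₀ q ≠ 0
    exact hq1 ▸ one_ne_zero
  obtain ⟨V₁, hV₁, rfl⟩ := isOpen_induced_iff.1 hV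
  obtain ⟨W, hW, rfl⟩ := isOpen_induced_iff.1 hV₁
  obtain ⟨O, hO, rfl⟩ := hindY.isOpen_iff.1 hW
  obtain ⟨O', hO', h⟩ := hrO O hO
  refine isOpen_induced_iff.2 ⟨_, isOpen_induced_iff.2 ⟨_, hindX.isOpen_iff.2 ⟨O', hO', rfl⟩, rfl⟩,
    ?_⟩
  ext x
  refine (h _ ⟨x.1.1, x.1.2, rfl⟩ (hq x.1 x.2)).trans ⟨?_, ?_⟩
  · rintro ⟨_, ⟨y, hy, rfl⟩, hyO, hyx⟩
    have hfy : f ⟨y, hy⟩ = x.1 :=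
      Subtype.ext (residuePoint_injective π ((hF ⟨y, hy⟩).symm.trans hyx))
    refine ⟨⟨⟨y, hy⟩, ?_⟩, hyO, Subtype.ext hfy⟩
    change evalOn X q (f ⟨y, hy⟩) ≠ 0
    rw [hfy]
    exact x.2
  · rintro ⟨y, hyO, rfl⟩
    exact ⟨_, ⟨y.1.1, y.1.2, rfl⟩, hyO, hF y.1⟩
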